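/- Let $\mathbb{N}^*$ be the set of finite strings of natural numbers. A continuous semimeasure on $\mathbb{N}^*$ is a map $\nu\colon\mathbb{N}^*\to[0,1]$ with $\nu(\langle\rangle)=1$ and $\sum_{i=0}^\infty \nu(\sigma^\frown\langle i\rangle)\le\nu(\sigma)$ for all $\sigma\in\mathbb{N}^*$. It is left r.e. if $\{(q,\sigma)\in\mathbb{Q}\times\mathbb{N}^* : q<\nu(\sigma)\}$ is recursively enumerable. A left r.e. continuous semimeasure $\mathbf{M}$ is universal if for every left r.e. continuous semimeasure $\nu$ there is $c\in\mathbb{N}$ with $\nu(\sigma)\le c\cdot\mathbf{M}(\sigma)$ for all $\sigma$. For $S\subseteq\mathbb{N}^*$ write $\mathbf{M}(S)=\sum_{\sigma\in S}\mathbf{M}(\sigma)$, and for $P\subseteq\mathbb{N}^{\mathbb{N}}$ write $P\restriction n=\{X\restriction n : X\in P\}$, where $X\restriction n=\langle X(0),\ldots,X(n-1)\rangle$. A set $P\subseteq\mathbb{N}^{\mathbb{N}}$ is a recursively bounded (r.b.) $\Pi^0_1$ class if there is a recursive predicate $R$ on $\mathbb{N}^*$ such that $X\in P\iff\forall n\,R(X\restriction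 n)$ for all $X\in\mathbb{N}^{\mathbb{N}}$, and there is a recursive $h\colon\mathbb{N}\to\mathbb{N}$ such that $X(n)<h(n)$ for all $X\in P$ and $n\in\mathbb{N}$. A map $\Psi\colon P\to\mathbb{N}^{\mathbb{N}}$ is a recursive functional if there is a single oracle program which, for every $X\in P$ and $n\in\mathbb{N}$, computes $\Psi(X)(n)$ on input $n$ with oracle $X$. Sets $P,Q\subseteq\mathbb{N}^{\mathbb{N}}$ are recursively homeomorphic if there is a bijection $\Psi\colon P\to Q$ such that $\Psi$ and $\Psi^{-1}$ are both recursive functionals. An order function $r\colon\mathbb{N}\to\mathbb{N}$ is a recursive, nondecreasing, unbounded function. Fix a universal left r.e. continuous semimeasure $\mathbf{M}$ on $\mathbb{N}^*$. A set $P\subseteq\mathbb{N}^{\mathbb{N}}$ is deep (with respect to $\mathbf{M}$) if it is an r.b. $\Pi^0_1$ class and there is an order function $r\colon\mathbb{N}\to\mathbb{N}$ such that $\mathbf{M}(P\restriction r(n))\le 2^{-n}$ for all $n\in\mathbb{N}$. Proposition. 1. Let $P$ be an r.b. $\Pi^0_1$ class and $\Psi\colon P\to\mathbb{N}^{\mathbb{N}}$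 a recursive functional. If $\Psi[P]$ is deep, then $P$ is deep. 2. Let $P$ and $Q$ be recursively homeomorphic r.b. $\Pi^0_1$ classes. Then $P$ is deep if and only if $Q$ is deep. -/

import Mathlib

open scoped ENNReal

namespace Depth

/-- The initial segment `X ↾ n = ⟨X 0, …, X (n - 1)⟩`. -/
def initSeg (X : ℕ → ℕ) (n : ℕ) : List ℕ := (List.range n).map X

/-- `P ↾ n = {X ↾ n | X ∈ P}`. -/
def restrict (P : Set (ℕ → ℕ)) (n : ℕ) : Set (List ℕ) := (fun X => initSeg X n) '' P

/-! ### Oracle computation -/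

/-- Programs for oracle computation on the natural numbers. The constructors are the clauses of
`Nat.RecursiveIn`; programs do not mention the oracle, so one program computes uniformly in it. -/
inductive OracleCode : Type
  | zero : OracleCode
  | succ : OracleCode
  | left : OracleCode
  | right : OracleCode
  | oracle : OracleCode
  | pair : OracleCode → OracleCode → OracleCode
  | comp : OracleCode → OracleCode → OracleCode
  | prec : OracleCode → OracleCode → OracleCode
  | rfind : OracleCode → OracleCode

/-- `OracleCode.eval g c` is the partial function computed by the program `c` with oracle `g`. -/
def OracleCode.eval (g : ℕ →. ℕ) : OracleCode → ℕ →. ℕ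
  | .zero => fun _ => Part.some 0
  | .succ => fun n => Part.some (n + 1)
  | .left => fun n => Part.some n.unpair.1
  | .right => fun n => Part.some n.unpair.2
  | .oracle => g
  | .pair c d => fun n => Nat.pair <$> c.eval g n <*> d.eval g n
  | .comp c d => fun n => d.eval g n >>= c.eval g
  | .prec c d => fun p =>
      p.unpair.2.rec (c.eval g p.unpair.1) fun y IH =>
        IH >>= fun i => d.eval g (Nat.pair p.unpair.1 (Nat.pair y i))
  | .rfind c => fun a =>
      Nat.rfind fun n => (fun m => decide (m = 0)) <$> c.eval g (Nat.pair a n)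

/-- `Ψ : P → ℕ^ℕ` is a recursive functional: a single program computes `n ↦ Ψ(X)(n)` from the
oracle `X`, for every `X ∈ P`. -/
def IsRecursiveFunctional {P : Set (ℕ → ℕ)} (Ψ : P → (ℕ → ℕ)) : Prop :=
  ∃ c : OracleCode, ∀ (X : P) (n : ℕ),
    c.eval (fun k => Part.some (X.1 k)) n = Part.some (Ψ X n)

/-- `P` and `Q` are recursively homeomorphic: there is a bijection from `P` onto `Q` such that it
and its inverse are recursive functionals. -/
def RecursivelyHomeomorphic (P Q : Set (ℕ → ℕ)) : Prop :=
  ∃ e : P ≃ Q, IsRecursiveFunctional (fun X : P => (e X : ℕ → ℕ)) ∧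
    IsRecursiveFunctional (fun Y : Q => (e.symm Y : ℕ → ℕ))

/-! ### Recursively bounded `Π⁰₁` classes -/

/-- `P` is a `Π⁰₁` class: `X ∈ P ↔ ∀ n, R (X ↾ n)` for some recursive predicate `R` on strings. -/
def IsPi01 (P : Set (ℕ → ℕ)) : Prop :=
  ∃ R : List ℕ → Prop, ComputablePred R ∧ ∀ X : ℕ → ℕ, X ∈ P ↔ ∀ n, R (initSeg X n)

/-- `P` is recursively bounded: some recursive `h` satisfies `X n < h n` for all `X ∈ P`
and all `n`. -/
def IsRecursivelyBounded (P : Set (ℕ → ℕ)) : Prop :=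
  ∃ h : ℕ → ℕ, Computable h ∧ ∀ X ∈ P, ∀ n, X n < h n

/-- `P` is a recursively bounded `Π⁰₁` class. -/
def IsRBPi01 (P : Set (ℕ → ℕ)) : Prop := IsPi01 P ∧ IsRecursivelyBounded P

/-! ### Semimeasures -/

/-- Continuous semimeasures on `ℕ*`. The values are extended nonnegative reals, so that infinite
sums need no summability conditions; they lie in `[0, 1]`. -/
structure IsContinuousSemimeasure (ν : List ℕ → ℝ≥0∞) : Prop where
  le_one : ∀ σ, ν σ ≤ 1
  nil_eq : ν [] = 1
  sum_le : ∀ σ, ∑' i : ℕ, ν (σ ++ [i]) ≤ ν σ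

/-- `ν` is left r.e.: the set of `(a, b, σ)` such that the rational `a / (b + 1)` is less than
`ν σ` is recursively enumerable. -/
def IsLeftRE (ν : List ℕ → ℝ≥0∞) : Prop :=
  REPred fun p : ℕ × ℕ × List ℕ => (p.1 : ℝ≥0∞) / ((p.2.1 : ℝ≥0∞) + 1) < ν p.2.2

/-- `M` is a universal left r.e. continuous semimeasure on `ℕ*`. -/
structure IsUniversalSemimeasure (M : List ℕ → ℝ≥0∞) : Prop where
  semimeasure : IsContinuousSemimeasure M
  leftRE : IsLeftRE M
  dominates : ∀ ν : List ℕ → ℝ≥0∞, IsContinuousSemimeasure ν → IsLeftRE ν →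
    ∃ c : ℕ, ∀ σ, ν σ ≤ (c : ℝ≥0∞) * M σ

/-! ### Depth -/

/-- Order functions `ℕ → ℕ`: recursive, nondecreasing and unbounded. -/
structure IsOrderFunction (r : ℕ → ℕ) : Prop where
  computable : Computable r
  monotone : Monotone r
  unbounded : ∀ m, ∃ n, m ≤ r n

/-- `r` is a modulus of depth for `P` with respect to `M`: `r` is an order function with
`M(P ↾ r(n)) ≤ 2⁻ⁿ` for all `n`, where `M(S) = ∑_{σ ∈ S} M(σ)`. -/
def IsModulusOfDepth (M : List ℕ → ℝ≥0∞) (P : Set (ℕ → ℕ)) (r : ℕ → ℕ) : Prop :=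
  IsOrderFunction r ∧ ∀ n : ℕ, ∑' σ : restrict P (r n), M σ.1 ≤ (2 : ℝ≥0∞)⁻¹ ^ n

/-- `P` is deep with respect to `M`. -/
def IsDeep (M : List ℕ → ℝ≥0∞) (P : Set (ℕ → ℕ)) : Prop :=
  IsRBPi01 P ∧ ∃ r : ℕ → ℕ, IsModulusOfDepth M P r

end Depth

namespace Depth

/-! ### Computable list operations -/

section ComputableList

variable {α β σ : Type*} [Primcodable α] [Primcodable β] [Primcodable σ]

/-! The idea for part 1 is to push `M` forward along `Ψ` and invoke universality. `P` is the set of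
paths of a recursive, recursively bounded tree, and `Ψ` is given by a monotone recursive
approximation `Φ` on strings (`OracleCode.exists_approximation`). As `Ψ` is total on `P`,
compactness yields for each `k` a level `g k` of the tree at which `Φ σ` is defined below `k` for
every string `σ`, dead ends included (`exists_level_definedBelow`). This condition is decidable, so
a search makes `g` recursive (`exists_computable_level`).

Let `ν τ` be the sum of `M σ` over the strings `σ` at level `g |τ|` for which `Φ σ` extends `τ`.
Passing to higher levels gains no mass, and different children of `τ` receive mass from disjoint
sets of strings, so `ν` is a semimeasure (`isContinuousSemimeasure_mass`). It is left r.e., being a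
finite sum over a computable list (`isLeftRE_list_sum`). Hence `ν ≤ C * M` for some `C`. Since `X ↾
g k` is mapped to an extension of `Ψ X ↾ k`, this gives `M(P ↾ g k) ≤ C * M(Ψ[P] ↾ k)`. If `r` is a
modulus for `Ψ[P]`, then `n ↦ g (r (n + C))` is one for `P`.

Part 2 applies part 1 to the homeomorphism and to its inverse. -/

theorem computable_list_foldl {f : α → List β} {g : α → σ} {h : α → σ → β → σ}
    (hf : Computable f) (hg : Computable g)
    (hh : Computable fun p : α × σ × β => h p.1 p.2.1 p.2.2) :
    Computable fun a => (f a).foldl (h a) (g a) := by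
  -- The fold becomes primitive recursion on the number of entries consumed; an index out of range
  -- leaves the state unchanged.
  have key : ∀ a n, Nat.rec (motive := fun _ => σ) (g a)
      (fun i s => Option.casesOn (motive := fun _ => σ) ((f a)[i]?) s (fun b => h a s b)) n
      = ((f a).take n).foldl (h a) (g a) := by
    intro a n
    induction n with
    | zero => simp
    | succ n ih =>
      simp only [ih]
      rw [List.take_add_one, List.foldl_append]
      cases (f a)[n]? <;> simp
  have hstep : Computable₂ fun (a : α) (p : ℕ × σ) =>
      Option.casesOn (motive := fun _ => σ) ((f a)[p.1]?) p.2 (fun b => h a p.2 b) := by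
    refine Computable.option_casesOn (o := fun q : α × ℕ × σ => (f q.1)[q.2.1]?)
      (f := fun q : α × ℕ × σ => q.2.2) (g := fun q b => h q.1 q.2.2 b) ?_ ?_ ?_
    · exact Computable.list_getElem?.comp (hf.comp Computable.fst)
        (Computable.fst.comp Computable.snd)
    · exact Computable.snd.comp Computable.snd
    · exact hh.comp ((Computable.fst.comp Computable.fst).pair
        ((Computable.snd.comp (Computable.snd.comp Computable.fst)).pair Computable.snd))
  refine (Computable.nat_rec (Computable.list_length.comp hf) hg hstep).of_eq fun a => ?_
  rw [key, List.take_length]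

theorem computable_list_flatMap {f : α → List β} {g : α → β → List σ}
    (hf : Computable f) (hg : Computable₂ g) : Computable fun a => (f a).flatMap (g a) := by
  refine (computable_list_foldl (g := fun _ => []) (h := fun a s b => s ++ g a b) hf
    (Computable.const _) ?_).of_eq fun a => ?_
  · exact Computable.list_append.comp (Computable.fst.comp Computable.snd)
      (hg.comp Computable.fst (Computable.snd.comp Computable.snd))
  · have : ∀ (l : List β) s, l.foldl (fun s b => s ++ g a b) s = s ++ l.flatMap (g a) := by
      intro l
      induction l with
      | nil => simp
      | cons b l ih => intro s; simp [ih]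
    simpa using this (f a) []

theorem computable_list_filter {f : α → List β} {g : α → β → Bool}
    (hf : Computable f) (hg : Computable₂ g) : Computable fun a => (f a).filter (g a) := by
  refine (computable_list_flatMap (g := fun a b => bif g a b then [b] else []) hf
    (Computable.cond hg (Computable.list_cons.comp Computable.snd (Computable.const []))
      (Computable.const []))).of_eq fun a => ?_
  induction f a with
  | nil => rfl
  | cons b l ih => cases h : g a b <;> simp_all

theorem computable_list_sum {f : α → List β} {g : α → β → ℕ}
    (hf : Computable f) (hg : Computable₂ g) : Computable fun a => ((f a).map (g a)).sum := by
  refine (computable_list_foldl (g := fun _ => 0) (h := fun a s b => s + g a b) hf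
    (Computable.const _) ?_).of_eq fun a => ?_
  · exact Primrec.nat_add.to_comp.comp (Computable.fst.comp Computable.snd)
      (hg.comp Computable.fst (Computable.snd.comp Computable.snd))
  · have : ∀ (l : List β) s, l.foldl (fun s b => s + g a b) s = s + (l.map (g a)).sum := by
      intro l
      induction l with
      | nil => simp
      | cons b l ih => intro s; simp [ih, add_assoc]
    simpa using this (f a) 0

theorem computable_list_all {f : α → List β} {g : α → β → Bool}
    (hf : Computable f) (hg : Computable₂ g) : Computable fun a => (f a).all (g a) := by
  refine (computable_list_foldl (g := fun _ => true) (h := fun a s b => s && g a b) hf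
    (Computable.const _) ?_).of_eq fun a => ?_
  · exact Primrec.and.to_comp.comp (Computable.fst.comp Computable.snd)
      (hg.comp Computable.fst (Computable.snd.comp Computable.snd))
  · have : ∀ (l : List β) s, l.foldl (fun s b => s && g a b) s = (s && l.all (g a)) := by
      intro l
      induction l with
      | nil => simp
      | cons b l ih => intro s; simp [ih, Bool.and_assoc]
    simpa using this (f a) true

/-- Stage-by-stage approximation of a partial recursive function. -/
theorem exists_stages {f : α →. σ} (hf : Partrec f) :
    ∃ d : α → ℕ → Option σ, Computable₂ d ∧
      (∀ a s t y, s ≤ t → d a s = some y → d a t = some y) ∧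
      ∀ a y, y ∈ f a ↔ ∃ s, d a s = some y := by
  obtain ⟨c, hc⟩ := Nat.Partrec.Code.exists_code.1 hf
  have hc' : ∀ a, c.eval (Encodable.encode a) = (f a).map Encodable.encode := by
    intro a; simp [hc]
  refine ⟨fun a s => (Nat.Partrec.Code.evaln s c (Encodable.encode a)).bind Encodable.decode,
    ?_, ?_, ?_⟩
  · refine Computable.option_bind (Nat.Partrec.Code.primrec_evaln.to_comp.comp
      ((Computable.snd.pair (Computable.const c)).pair
        (Computable.encode.comp Computable.fst))) ?_
    exact Computable.decode.comp Computable.snd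
  · intro a s t y hst h
    obtain ⟨x, hx, hy⟩ := Option.bind_eq_some_iff.1 h
    exact Option.bind_eq_some_iff.2 ⟨x, Nat.Partrec.Code.evaln_mono hst hx, hy⟩
  · intro a y
    constructor
    · intro h
      have : Encodable.encode y ∈ c.eval (Encodable.encode a) := by
        rw [hc']; exact Part.mem_map _ h
      obtain ⟨s, hs⟩ := Nat.Partrec.Code.evaln_complete.1 this
      exact ⟨s, Option.bind_eq_some_iff.2 ⟨_, hs, Encodable.encodek y⟩⟩
    · rintro ⟨s, hs⟩
      obtain ⟨x, hx, hy⟩ := Option.bind_eq_some_iff.1 hs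
      have := Nat.Partrec.Code.evaln_sound hx
      rw [hc'] at this
      obtain ⟨z, hz, rfl⟩ := (Part.mem_map_iff _).1 this
      rw [Encodable.encodek] at hy
      cases hy
      exact hz

theorem REPred.exists_stages {p : α → Prop} (hp : REPred p) :
    ∃ d : α → ℕ → Bool, Computable₂ d ∧ (∀ a s t, s ≤ t → d a s → d a t) ∧
      ∀ a, p a ↔ ∃ s, d a s := by
  obtain ⟨d, hd, hmono, hspec⟩ := Depth.exists_stages hp
  refine ⟨fun a s => (d a s).isSome, Primrec.option_isSome.to_comp.comp hd, ?_, ?_⟩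
  · intro a s t hst h
    obtain ⟨y, hy⟩ := Option.isSome_iff_exists.1 h
    simp [hmono a s t y hst hy]
  · intro a
    have := hspec a ()
    simp only [Part.mem_assert_iff, Part.mem_some_iff, exists_prop, and_true] at this
    rw [this]
    simp only [Option.isSome_iff_exists]
    exact exists_congr fun s => ⟨fun h => ⟨(), h⟩, fun ⟨_, h⟩ => h⟩

theorem rePred_exists {q : α → ℕ → Bool} (hq : Computable₂ q) :
    REPred fun a => ∃ n, q a n = true := by
  refine (Partrec.rfind (p := fun a n => Part.some (q a n)) hq.partrec₂).dom_re.of_eq fun a => ?_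
  refine (Nat.rfind_dom' (p := fun n => Part.some (q a n))).trans (exists_congr fun n => ?_)
  exact ⟨fun h => (Part.mem_some_iff.1 h.1).symm,
    fun h => ⟨Part.mem_some_iff.2 h.symm, fun _ => trivial⟩⟩

end ComputableList

/-! ### Oracle programs with finite oracles -/

/-- A finite string regarded as a partial oracle. -/
def stringOracle (σ : List ℕ) : ℕ →. ℕ := fun k => (σ[k]? : Part ℕ)

theorem mem_stringOracle {σ : List ℕ} {k y : ℕ} : y ∈ stringOracle σ k ↔ σ[k]? = some y := by
  simp [stringOracle]

theorem partrec_pair_seq {α : Type*} [Primcodable α] {f g : α →. ℕ} (hf : Partrec f)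
    (hg : Partrec g) : Partrec fun a => Nat.pair <$> f a <*> g a := by
  have hg' : Partrec fun p : α × ℕ => (g p.1).map fun z => Nat.pair p.2 z :=
    Partrec.map (f := fun p : α × ℕ => g p.1) (g := fun p z => Nat.pair p.2 z)
      (hg.comp Computable.fst)
      (Primrec₂.natPair.to_comp.comp (Computable.snd.comp Computable.fst) Computable.snd)
  refine (Partrec.bind (g := fun a y => (g a).map fun z => Nat.pair y z) hf hg'.to₂).of_eq
    fun a => ?_
  simp [Seq.seq, Part.bind_map]

/-- The string is carried along as an extra input, and each program constructor matches a closure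
property of partial recursive functions. Queries beyond the end of the string diverge. -/
theorem partrec_eval_stringOracle (c : OracleCode) :
    Partrec fun p : List ℕ × ℕ => c.eval (stringOracle p.1) p.2 := by
  have hu := Computable.unpair.comp (Computable.snd (α := List ℕ) (β := ℕ))
  induction c with
  | zero => exact (Computable.const 0).partrec
  | succ => exact (Computable.succ.comp Computable.snd).partrec
  | left => exact (Computable.fst.comp hu).partrec
  | right => exact (Computable.snd.comp hu).partrec
  | oracle =>
    exact (Computable.list_getElem?.comp Computable.fst Computable.snd).ofOption
  | pair c d hc hd => exact partrec_pair_seq hc hd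
  | comp c d hc hd =>
    exact Partrec.bind (f := fun p : List ℕ × ℕ => d.eval (stringOracle p.1) p.2)
      (g := fun p y => c.eval (stringOracle p.1) y) hd
      (Partrec.comp (f := fun p : List ℕ × ℕ => c.eval (stringOracle p.1) p.2)
        (g := fun q : (List ℕ × ℕ) × ℕ => (q.1.1, q.2)) hc
        ((Computable.fst.comp Computable.fst).pair Computable.snd))
  | prec c d hc hd =>
    refine Partrec.nat_rec (f := fun p : List ℕ × ℕ => p.2.unpair.2)
      (g := fun p : List ℕ × ℕ => c.eval (stringOracle p.1) p.2.unpair.1)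
      (h := fun p q => d.eval (stringOracle p.1) (Nat.pair p.2.unpair.1 (Nat.pair q.1 q.2)))
      (Computable.snd.comp hu) (hc.comp (Computable.fst.pair (Computable.fst.comp hu))) ?_
    refine hd.comp ((Computable.fst.comp Computable.fst).pair
      (Primrec₂.natPair.to_comp.comp (Computable.fst.comp (hu.comp Computable.fst))
        (Primrec₂.natPair.to_comp.comp (Computable.fst.comp Computable.snd)
          (Computable.snd.comp Computable.snd))))
  | rfind c hc =>
    refine Partrec.rfind (p := fun (p : List ℕ × ℕ) n => (fun m => decide (m = 0)) <$>
      c.eval (stringOracle p.1) (Nat.pair p.2 n)) ?_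
    refine (hc.comp ((Computable.fst.comp Computable.fst).pair
      (Primrec₂.natPair.to_comp.comp (Computable.snd.comp Computable.fst)
        Computable.snd))).map ?_
    exact ((PrimrecPred.decide (Primrec.eq.comp Primrec.id (Primrec.const 0))).to_comp.comp
      Computable.snd).to₂

theorem OracleCode.mem_eval_pair {g : ℕ →. ℕ} {c d : OracleCode} {n y : ℕ} :
    y ∈ (pair c d).eval g n ↔ ∃ a ∈ c.eval g n, ∃ b ∈ d.eval g n, y = Nat.pair a b := by
  simp [eval, Seq.seq, eq_comm]

theorem OracleCode.mem_eval_comp {g : ℕ →. ℕ} {c d : OracleCode} {n y : ℕ} :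
    y ∈ (comp c d).eval g n ↔ ∃ a ∈ d.eval g n, y ∈ c.eval g a :=
  Part.mem_bind_iff

theorem OracleCode.mem_eval_prec_zero {g : ℕ →. ℕ} {c d : OracleCode} {a y : ℕ} :
    y ∈ (prec c d).eval g (Nat.pair a 0) ↔ y ∈ c.eval g a := by
  simp [eval]

theorem OracleCode.mem_eval_prec_succ {g : ℕ →. ℕ} {c d : OracleCode} {a m y : ℕ} :
    y ∈ (prec c d).eval g (Nat.pair a (m + 1)) ↔
      ∃ i ∈ (prec c d).eval g (Nat.pair a m), y ∈ d.eval g (Nat.pair a (Nat.pair m i)) := by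
  simp [eval]

theorem OracleCode.mem_eval_rfind {g : ℕ →. ℕ} {c : OracleCode} {n y : ℕ} :
    y ∈ (rfind c).eval g n ↔ 0 ∈ c.eval g (Nat.pair n y) ∧
      ∀ m < y, ∃ b ∈ c.eval g (Nat.pair n m), b ≠ 0 := by
  refine Nat.mem_rfind.trans (and_congr ?_ (forall_congr' fun m => ?_))
  · refine (Part.mem_map_iff _).trans ⟨?_, fun h => ⟨0, h, rfl⟩⟩
    rintro ⟨a, ha, h0⟩
    rwa [of_decide_eq_true h0] at ha
  · refine imp_congr_right fun _ => (Part.mem_map_iff _).trans (exists_congr fun b => ?_)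
    simp

theorem OracleCode.eval_mono {g g' : ℕ →. ℕ} (h : ∀ k, ∀ y ∈ g k, y ∈ g' k) (c : OracleCode) :
    ∀ n, ∀ y ∈ c.eval g n, y ∈ c.eval g' n := by
  induction c with
  | zero | succ | left | right => intro n y hy; exact hy
  | oracle => exact h
  | pair c d hc hd =>
    intro n y hy
    obtain ⟨a, ha, b, hb, rfl⟩ := mem_eval_pair.1 hy
    exact mem_eval_pair.2 ⟨a, hc _ _ ha, b, hd _ _ hb, rfl⟩
  | comp c d hc hd =>
    intro n y hy
    obtain ⟨a, ha, hy⟩ := mem_eval_comp.1 hy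
    exact mem_eval_comp.2 ⟨a, hd _ _ ha, hc _ _ hy⟩
  | prec c d hc hd =>
    intro n y
    rw [← Nat.pair_unpair n]
    induction n.unpair.2 generalizing y with
    | zero => simpa only [mem_eval_prec_zero] using hc _ _
    | succ m ih =>
      simp only [mem_eval_prec_succ]
      rintro ⟨a, ha, hy⟩
      exact ⟨a, ih _ ha, hd _ _ hy⟩
  | rfind c hc =>
    intro n y hy
    obtain ⟨h0, hlt⟩ := mem_eval_rfind.1 hy
    refine mem_eval_rfind.2 ⟨hc _ _ h0, fun m hm => ?_⟩
    obtain ⟨b, hb, h1⟩ := hlt m hm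
    exact ⟨b, hc _ _ hb, h1⟩

theorem getElem?_initSeg (X : ℕ → ℕ) (n k : ℕ) :
    (initSeg X n)[k]? = if k < n then some (X k) else none := by
  rw [initSeg, List.getElem?_map]
  split_ifs with h
  · simp [h]
  · simp [Nat.le_of_not_lt h]

theorem length_initSeg (X : ℕ → ℕ) (n : ℕ) : (initSeg X n).length = n := by simp [initSeg]

theorem take_initSeg (X : ℕ → ℕ) {n m : ℕ} (h : n ≤ m) : (initSeg X m).take n = initSeg X n := by
  rw [initSeg, ← List.map_take, List.take_range, min_eq_left h, initSeg]

theorem initSeg_succ (X : ℕ → ℕ) (n : ℕ) : initSeg X (n + 1) = initSeg X n ++ [X n] := by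
  simp [initSeg, List.range_succ]

theorem eval_initSeg_mono (X : ℕ → ℕ) (c : OracleCode) {l m : ℕ} (h : l ≤ m) {n y : ℕ}
    (hy : y ∈ c.eval (stringOracle (initSeg X l)) n) :
    y ∈ c.eval (stringOracle (initSeg X m)) n := by
  refine c.eval_mono (fun k z hz => ?_) n y hy
  rw [mem_stringOracle, getElem?_initSeg] at hz ⊢
  split_ifs at hz with hk
  rwa [if_pos (hk.trans_le h)]

/-- The use principle: a halting computation consults a finite part of the oracle. -/
theorem OracleCode.exists_use (X : ℕ → ℕ) (c : OracleCode) :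
    ∀ n, ∀ y ∈ c.eval (fun k => Part.some (X k)) n,
      ∃ l, y ∈ c.eval (stringOracle (initSeg X l)) n := by
  induction c with
  | zero | succ | left | right => intro n y hy; exact ⟨0, hy⟩
  | oracle =>
    intro n y hy
    refine ⟨n + 1, ?_⟩
    have : y = X n := by simpa [eval] using hy
    simp only [eval, mem_stringOracle, getElem?_initSeg]
    simp [this]
  | pair c d hc hd =>
    intro n y hy
    obtain ⟨a, ha, b, hb, rfl⟩ := mem_eval_pair.1 hy
    obtain ⟨l, hl⟩ := hc _ _ ha
    obtain ⟨m, hm⟩ := hd _ _ hb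
    exact ⟨max l m, mem_eval_pair.2 ⟨a, eval_initSeg_mono X c (le_max_left _ _) hl, b,
      eval_initSeg_mono X d (le_max_right _ _) hm, rfl⟩⟩
  | comp c d hc hd =>
    intro n y hy
    obtain ⟨a, ha, hy⟩ := mem_eval_comp.1 hy
    obtain ⟨l, hl⟩ := hd _ _ ha
    obtain ⟨m, hm⟩ := hc _ _ hy
    exact ⟨max l m, mem_eval_comp.2 ⟨a, eval_initSeg_mono X d (le_max_left _ _) hl,
      eval_initSeg_mono X c (le_max_right _ _) hm⟩⟩
  | prec c d hc hd =>
    intro n y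
    rw [← Nat.pair_unpair n]
    induction n.unpair.2 generalizing y with
    | zero =>
      intro hy
      obtain ⟨l, hl⟩ := hc _ _ (mem_eval_prec_zero.1 hy)
      exact ⟨l, mem_eval_prec_zero.2 hl⟩
    | succ m ih =>
      intro hy
      obtain ⟨a, ha, hy⟩ := mem_eval_prec_succ.1 hy
      obtain ⟨l, hl⟩ := ih _ ha
      obtain ⟨l', hl'⟩ := hd _ _ hy
      exact ⟨max l l', mem_eval_prec_succ.2 ⟨a, eval_initSeg_mono X _ (le_max_left _ _) hl,
        eval_initSeg_mono X d (le_max_right _ _) hl'⟩⟩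
  | rfind c hc =>
    intro n y hy
    obtain ⟨h0, hlt⟩ := mem_eval_rfind.1 hy
    -- Each of the `y` failed tests before the minimum has its own use; the maximum of these
    -- finitely many uses serves them all.
    have hex : ∀ m, ∃ l, m < y → ∃ b ∈ c.eval (stringOracle (initSeg X l)) (Nat.pair n m),
        b ≠ 0 := by
      intro m
      by_cases hm : m < y
      · obtain ⟨b, hb, h1⟩ := hlt m hm
        obtain ⟨l, hl⟩ := hc _ _ hb
        exact ⟨l, fun _ => ⟨b, hl, h1⟩⟩
      · exact ⟨0, fun h => absurd h hm⟩
    choose u hu using hex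
    obtain ⟨l, hl⟩ := hc _ _ h0
    refine ⟨max l ((Finset.range y).sup u), mem_eval_rfind.2
      ⟨eval_initSeg_mono X c (le_max_left _ _) hl, fun m hm => ?_⟩⟩
    obtain ⟨b, hb, h1⟩ := hu m hm
    refine ⟨b, eval_initSeg_mono X c ?_ hb, h1⟩
    exact (Finset.le_sup (f := u) (Finset.mem_range.2 hm)).trans (le_max_right _ _)

/-- A monotone total recursive approximation of an oracle program on finite strings. -/
theorem OracleCode.exists_approximation (c : OracleCode) :
    ∃ Φ : List ℕ → ℕ → Option ℕ, Computable₂ Φ ∧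
      (∀ σ ρ n y, Φ σ n = some y → Φ (σ ++ ρ) n = some y) ∧
      ∀ (X : ℕ → ℕ) n y, y ∈ c.eval (fun k => Part.some (X k)) n ↔
        ∃ l, Φ (initSeg X l) n = some y := by
  obtain ⟨d, hd, hmono, hspec⟩ := exists_stages (partrec_eval_stringOracle c)
  have hor : ∀ (f : ℕ → Option ℕ) (l : List ℕ) (o : Option ℕ),
      l.foldl (fun s j => s.or (f j)) o = o.or (l.findSome? f) := by
    intro f l
    induction l with
    | nil => simp
    | cons b l ih => intro o; cases o <;> cases h : f b <;> simp [ih, h]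
  -- The program is run for `|σ|` stages on every prefix of `σ`. Running it on `σ` alone could break
  -- monotonicity in `σ`, since a longer oracle string may need more stages. Answers from different
  -- prefixes agree, all being correct for the oracle `σ`.
  let Φ : List ℕ → ℕ → Option ℕ := fun σ n =>
    (List.range (σ.length + 1)).findSome? fun j => d (σ.take j, n) σ.length
  have hsound : ∀ σ n y, Φ σ n = some y → y ∈ c.eval (stringOracle σ) n := by
    intro σ n y h
    obtain ⟨j, -, hj⟩ := List.exists_of_findSome?_eq_some h
    refine c.eval_mono (fun k z hz => ?_) n y ((hspec (σ.take j, n) y).2 ⟨_, hj⟩)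
    rw [mem_stringOracle] at hz ⊢
    rw [List.getElem?_take] at hz
    split_ifs at hz
    exact hz
  have hcomplete : ∀ σ n y j s, j ≤ σ.length → s ≤ σ.length → d (σ.take j, n) s = some y →
      Φ σ n = some y := by
    intro σ n y j s hj hs h
    have hy := hmono _ _ _ _ hs h
    have hsome : (Φ σ n).isSome := by
      rw [List.findSome?_isSome_iff]
      exact ⟨j, List.mem_range.2 (by omega), by simp [hy]⟩
    obtain ⟨z, hz⟩ := Option.isSome_iff_exists.1 hsome
    have h1 := hsound _ _ _ hz
    have h2 : y ∈ c.eval (stringOracle σ) n := by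
      refine c.eval_mono (fun k z hz => ?_) n y ((hspec (σ.take j, n) y).2 ⟨_, h⟩)
      rw [mem_stringOracle] at hz ⊢
      rw [List.getElem?_take] at hz
      split_ifs at hz
      exact hz
    rw [hz, Part.mem_unique h1 h2]
  refine ⟨Φ, ?_, ?_, ?_⟩
  · refine (computable_list_foldl (α := List ℕ × ℕ) (f := fun p => List.range (p.1.length + 1))
      (g := fun _ => none) (h := fun p s j => s.or (d (p.1.take j, p.2) p.1.length)) ?_
      (Computable.const _) ?_).of_eq fun p => by rw [hor]; simp [Φ]
    · exact Primrec.list_range.to_comp.comp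
        (Computable.succ.comp (Computable.list_length.comp Computable.fst))
    · have htake : Computable₂ fun (σ : List ℕ) (j : ℕ) => σ.take j := by
        refine (computable_list_flatMap (α := List ℕ × ℕ) (f := fun p => List.range p.2)
          (g := fun p i => p.1[i]?.toList) (Primrec.list_range.to_comp.comp Computable.snd)
          ?_).of_eq fun p => ?_
        · refine (Computable.option_casesOn
            (o := fun q : (List ℕ × ℕ) × ℕ => q.1.1[q.2]?) (f := fun _ => ([] : List ℕ))
            (g := fun _ y => [y])
            (Computable.list_getElem?.comp (Computable.fst.comp Computable.fst) Computable.snd)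
            (Computable.const _)
            (Computable.list_cons.comp Computable.snd (Computable.const [])).to₂).of_eq ?_
          intro q
          dsimp only
          cases q.1.1[q.2]? <;> rfl
        · obtain ⟨σ, j⟩ := p
          induction j with
          | zero => simp
          | succ j ih => simp_all [List.range_succ, List.take_add_one]
      have horc : Computable₂ (Option.or : Option ℕ → Option ℕ → Option ℕ) := by
        refine (Computable.option_casesOn (o := fun q : Option ℕ × Option ℕ => q.1)
          (f := fun q => q.2) (g := fun _ y => some y) Computable.fst Computable.snd
          (Computable.option_some.comp Computable.snd).to₂).of_eq ?_
        rintro ⟨_ | _, _⟩ <;> rfl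
      refine horc.comp (Computable.fst.comp Computable.snd) ?_
      have h1 := Computable.fst (α := List ℕ × ℕ) (β := Option ℕ × ℕ)
      exact hd.comp ((htake.comp (Computable.fst.comp h1)
        (Computable.snd.comp Computable.snd)).pair (Computable.snd.comp h1))
        (Computable.list_length.comp (Computable.fst.comp h1))
  · intro σ ρ n y h
    obtain ⟨j, hj, hy⟩ := List.exists_of_findSome?_eq_some h
    have hj' : j ≤ σ.length := by have := List.mem_range.1 hj; omega
    refine hcomplete _ n y j σ.length (by simp; omega) (by simp) ?_
    rwa [List.take_append_of_le_length hj']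
  · intro X n y
    constructor
    · intro h
      obtain ⟨l, hl⟩ := c.exists_use X n y h
      obtain ⟨s, hs⟩ := (hspec (initSeg X l, n) y).1 hl
      refine ⟨max l s, hcomplete _ n y l s (by simp [length_initSeg]) (by simp [length_initSeg]) ?_⟩
      rwa [take_initSeg X (le_max_left _ _)]
    · rintro ⟨l, hl⟩
      refine c.eval_mono (fun k z hz => ?_) n y (hsound _ _ _ hl)
      rw [mem_stringOracle, getElem?_initSeg] at hz
      split_ifs at hz
      simpa [eq_comm] using hz

/-! ### List sums of extended nonnegative reals -/

section ListSum

variable {α β : Type*}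

theorem sum_map_filter_eq (L : List α) (p : α → Bool) (w : α → ℝ≥0∞) :
    ((L.filter p).map w).sum = (L.map fun a => if p a then w a else 0).sum := by
  induction L with
  | nil => simp
  | cons a L ih => cases h : p a <;> simp [h, ih]

theorem sum_map_flatMap_eq (L : List α) (f : α → List β) (w : β → ℝ≥0∞) :
    ((L.flatMap f).map w).sum = (L.map fun a => ((f a).map w).sum).sum := by
  induction L with
  | nil => simp
  | cons a L ih => simp [ih]

theorem tsum_list_sum (L : List α) (f : β → α → ℝ≥0∞) :
    ∑' i, (L.map (f i)).sum = (L.map fun a => ∑' i, f i a).sum := by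
  induction L with
  | nil => simp
  | cons a L ih => simp [ENNReal.tsum_add, ih]

theorem sum_map_range_le_tsum (n : ℕ) (f : ℕ → ℝ≥0∞) :
    ((List.range n).map f).sum ≤ ∑' i, f i := by
  have : ((List.range n).map f).sum = ∑ i ∈ Finset.range n, f i := by
    induction n with
    | zero => simp
    | succ n ih => simp [List.range_succ, Finset.sum_range_succ, ih]
  rw [this]
  exact ENNReal.sum_le_tsum _

/-- Repetitions in `L` only increase the right-hand side, so no absence of duplicates is required.
-/
theorem tsum_subtype_le_list_sum (S : Set α) (L : List α) (hS : ∀ x ∈ S, x ∈ L)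
    (f : α → ℝ≥0∞) : ∑' x : S, f x ≤ (L.map f).sum := by
  have key : ∑' x, {x | x ∈ L}.indicator f x ≤ (L.map f).sum := by
    clear hS
    induction L with
    | nil => simp
    | cons a L ih =>
      have hle : ∀ x, {x | x ∈ a :: L}.indicator f x ≤
          ({a} : Set α).indicator f x + {x | x ∈ L}.indicator f x := by
        intro x
        by_cases hx : x ∈ a :: L
        · rw [Set.indicator_of_mem (by exact hx)]
          rcases List.mem_cons.1 hx with rfl | h
          · simp
          · rw [Set.indicator_of_mem (s := {x | x ∈ L}) (by exact h)]
            exact le_add_self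
        · rw [Set.indicator_of_notMem (by exact hx)]
          exact zero_le
      refine (ENNReal.tsum_le_tsum hle).trans ?_
      rw [ENNReal.tsum_add, ← tsum_subtype, List.map_cons, List.sum_cons]
      simpa using add_le_add_right ih (f a)
  rw [tsum_subtype]
  refine (ENNReal.tsum_le_tsum fun x => ?_).trans key
  exact Set.indicator_le_indicator_of_subset hS (fun _ => zero_le) x

end ListSum

/-! ### Finite sums of left r.e. semimeasures -/

/-- The number of `a ≤ s`, `a ≥ 1`, for which `a / (s + 1) < M σ` is confirmed by stage `t`. -/
def lowerCount (d : ℕ × ℕ × List ℕ → ℕ → Bool) (s t : ℕ) (σ : List ℕ) : ℕ :=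
  ((List.range (s + 1)).map fun a => (d (a + 1, s, σ) t).toNat).sum

theorem lowerCount_eq_card (d : ℕ × ℕ × List ℕ → ℕ → Bool) (s t : ℕ) (σ : List ℕ) :
    lowerCount d s t σ = ((Finset.range (s + 1)).filter fun a => d (a + 1, s, σ) t).card := by
  unfold lowerCount
  induction s + 1 with
  | zero => simp
  | succ n ih =>
    rw [List.range_succ, List.map_append, List.sum_append, Finset.range_add_one,
      Finset.filter_insert]
    simp only [List.map_cons, List.map_nil, List.sum_cons, List.sum_nil, add_zero]
    cases h : d (n + 1, s, σ) t
    · simpa using ih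
    · simpa [Finset.card_insert_of_notMem] using ih

section Lower

variable {M : List ℕ → ℝ≥0∞} {d : ℕ × ℕ × List ℕ → ℕ → Bool}

theorem lowerCount_div_le
    (hspec : ∀ p : ℕ × ℕ × List ℕ, (p.1 : ℝ≥0∞) / ((p.2.1 : ℝ≥0∞) + 1) < M p.2.2 ↔ ∃ t, d p t)
    (s t : ℕ) (σ : List ℕ) : (lowerCount d s t σ : ℝ≥0∞) / ((s : ℝ≥0∞) + 1) ≤ M σ := by
  rw [lowerCount_eq_card]
  set F := (Finset.range (s + 1)).filter fun a => d (a + 1, s, σ) t with hF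
  rcases Nat.eq_zero_or_pos F.card with h0 | hpos
  · simp [h0]
  -- At a fixed stage the confirmed numerators need not form an initial segment, but `m > 0`
  -- distinct naturals always include one that is at least `m - 1`.
  · have : ∃ a ∈ F, F.card ≤ a + 1 := by
      by_contra! hcon
      have hsub : F ⊆ Finset.range (F.card - 1) := fun a ha => by
        have := hcon a ha
        exact Finset.mem_range.2 (by omega)
      have := Finset.card_le_card hsub
      rw [Finset.card_range] at this
      omega
    obtain ⟨a, ha, hle⟩ := this
    have hlt := (hspec (a + 1, s, σ)).2 ⟨t, (Finset.mem_filter.1 ha).2⟩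
    refine le_trans ?_ hlt.le
    exact ENNReal.div_le_div_right (by exact_mod_cast hle) _

/-- For fixed `s` only finitely many fractions have to be confirmed, so from some stage on the count
is final. As `M σ ≤ 1`, numerators up to `s + 1` suffice to locate `M σ` within `1 / (s + 1)`. -/
theorem exists_le_lowerCount_div (hM : ∀ σ, M σ ≤ 1)
    (hmono : ∀ p s t, s ≤ t → d p s → d p t)
    (hspec : ∀ p : ℕ × ℕ × List ℕ, (p.1 : ℝ≥0∞) / ((p.2.1 : ℝ≥0∞) + 1) < M p.2.2 ↔ ∃ t, d p t)
    (s : ℕ) (σ : List ℕ) :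
    ∃ t₀, ∀ t, t₀ ≤ t → M σ ≤ ((lowerCount d s t σ : ℝ≥0∞) + 1) / ((s : ℝ≥0∞) + 1) := by
  have hex : ∀ a, ∃ t, (∃ t', d (a + 1, s, σ) t') → d (a + 1, s, σ) t := fun a => by
    by_cases h : ∃ t', d (a + 1, s, σ) t'
    · exact ⟨_, fun _ => h.choose_spec⟩
    · exact ⟨0, fun h' => absurd h' h⟩
  choose u hu using hex
  refine ⟨(Finset.range (s + 1)).sup u, fun t ht => ?_⟩
  rw [lowerCount_eq_card]
  set F := (Finset.range (s + 1)).filter fun a => d (a + 1, s, σ) t with hF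
  by_contra! hcon
  have hs0 : (s : ℝ≥0∞) + 1 ≠ 0 := by simp
  have hsT : (s : ℝ≥0∞) + 1 ≠ ⊤ := by simp
  have hlt : F.card + 1 < s + 1 := by
    have h1 : ((F.card : ℝ≥0∞) + 1) / ((s : ℝ≥0∞) + 1) < 1 := hcon.trans_le (hM σ)
    rw [ENNReal.div_lt_iff (Or.inl hs0) (Or.inl hsT), one_mul] at h1
    exact_mod_cast h1
  have hsub : Finset.range (F.card + 1) ⊆ F := fun a ha => by
    have ha' := Finset.mem_range.1 ha
    have has : a ∈ Finset.range (s + 1) := Finset.mem_range.2 (by omega)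
    refine Finset.mem_filter.2 ⟨has, ?_⟩
    refine hmono _ (u a) t ((Finset.le_sup has).trans ht) (hu a ((hspec (a + 1, s, σ)).1 ?_))
    refine lt_of_le_of_lt ?_ hcon
    exact ENNReal.div_le_div_right (by exact_mod_cast ha') _
  have := Finset.card_le_card hsub
  rw [Finset.card_range] at this
  omega

/-- Rounding to multiples of `1 / (s + 1)` costs at most `|L| / (s + 1)` at late stages, so a strict
inequality survives for large `s`. Clearing denominators leaves a decidable comparison of naturals.
-/
theorem lt_list_sum_iff (hM : ∀ σ, M σ ≤ 1) (hmono : ∀ p s t, s ≤ t → d p s → d p t)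
    (hspec : ∀ p : ℕ × ℕ × List ℕ, (p.1 : ℝ≥0∞) / ((p.2.1 : ℝ≥0∞) + 1) < M p.2.2 ↔ ∃ t, d p t)
    (a b : ℕ) (L : List (List ℕ)) :
    (a : ℝ≥0∞) / ((b : ℝ≥0∞) + 1) < (L.map M).sum ↔
      ∃ s t, a * (s + 1) < (L.map (lowerCount d s t)).sum * (b + 1) := by
  have hdiv : ∀ s t, (L.map fun σ => (lowerCount d s t σ : ℝ≥0∞) / ((s : ℝ≥0∞) + 1)).sum =
      ((L.map (lowerCount d s t)).sum : ℕ) / ((s : ℝ≥0∞) + 1) := by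
    intro s t
    induction L with
    | nil => simp
    | cons σ L ih => simp [ih, ENNReal.add_div]
  have hcross : ∀ s n : ℕ, (a : ℝ≥0∞) / ((b : ℝ≥0∞) + 1) < (n : ℝ≥0∞) / ((s : ℝ≥0∞) + 1) ↔
      a * (s + 1) < n * (b + 1) := by
    intro s n
    rw [ENNReal.div_lt_iff (by simp) (by simp), ENNReal.mul_comm_div, ← mul_div_assoc,
      ENNReal.lt_div_iff_mul_lt (by simp) (by simp)]
    norm_cast
  constructor
  · intro hlt
    obtain ⟨s, hs⟩ : ∃ s : ℕ, (a : ℝ≥0∞) / ((b : ℝ≥0∞) + 1) + L.length / ((s : ℝ≥0∞) + 1) <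
        (L.map M).sum := by
      obtain ⟨e, he, heq⟩ : ∃ e, 0 < e ∧
          (a : ℝ≥0∞) / ((b : ℝ≥0∞) + 1) + e = (L.map M).sum :=
        ⟨_, tsub_pos_of_lt hlt, add_tsub_cancel_of_le hlt.le⟩
      obtain ⟨s, hs⟩ := ENNReal.exists_nat_mul_gt (a := e) (b := L.length) he.ne' (by simp)
      refine ⟨s, ?_⟩
      rw [← heq]
      refine ENNReal.add_lt_add_left (ENNReal.div_ne_top (by simp) (by simp)) ?_
      rw [ENNReal.div_lt_iff (by simp) (by simp), mul_comm]
      exact hs.trans_le (by gcongr; exact le_self_add)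
    have hex := exists_le_lowerCount_div hM hmono hspec s
    choose u hu using hex
    obtain ⟨t, ht⟩ : ∃ t, ∀ σ ∈ L, u σ ≤ t :=
      ⟨L.toFinset.sup u, fun σ hσ => Finset.le_sup (by simpa using hσ)⟩
    refine ⟨s, t, (hcross s _).1 ?_⟩
    have hle : (L.map M).sum ≤ ((L.map (lowerCount d s t)).sum : ℕ) / ((s : ℝ≥0∞) + 1) +
        L.length / ((s : ℝ≥0∞) + 1) := by
      refine (List.sum_le_sum fun σ hσ => hu σ t (ht σ hσ)).trans (le_of_eq ?_)
      rw [← hdiv]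
      clear hdiv hs hlt ht
      induction L with
      | nil => simp
      | cons σ L ih =>
        simp only [List.map_cons, List.sum_cons, List.length_cons, Nat.cast_add, Nat.cast_one]
        rw [ih, ENNReal.add_div, ENNReal.add_div, add_add_add_comm,
          add_comm (1 / ((s : ℝ≥0∞) + 1))]
    by_contra! hcon
    exact absurd (hs.trans_le (hle.trans (by gcongr))) (lt_irrefl _)
  · rintro ⟨s, t, h⟩
    refine ((hcross s _).2 h).trans_le ?_
    rw [← hdiv]
    exact List.sum_le_sum fun σ _ => lowerCount_div_le hspec s t σ

end Lower

theorem computable_list_map {α β σ : Type*} [Primcodable α] [Primcodable β] [Primcodable σ]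
    {f : α → List β} {g : α → β → σ} (hf : Computable f) (hg : Computable₂ g) :
    Computable fun a => (f a).map (g a) :=
  (computable_list_flatMap (g := fun a b => [g a b]) hf
    (Computable.list_cons.comp hg (Computable.const []))).of_eq fun a => by
      rw [List.map_eq_flatMap]

theorem isLeftRE_list_sum {M : List ℕ → ℝ≥0∞} (hM : ∀ σ, M σ ≤ 1) (hre : IsLeftRE M)
    {L : List ℕ → List (List ℕ)} (hL : Computable L) :
    IsLeftRE fun τ => ((L τ).map M).sum := by
  obtain ⟨d, hd, hmono, hspec⟩ := REPred.exists_stages hre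
  have hcount : Computable fun p : (ℕ × ℕ) × List ℕ => lowerCount d p.1.1 p.1.2 p.2 := by
    refine computable_list_sum (f := fun p : (ℕ × ℕ) × List ℕ => List.range (p.1.1 + 1))
      (g := fun p a => (d (a + 1, p.1.1, p.2) p.1.2).toNat) ?_ ?_
    · exact Primrec.list_range.to_comp.comp
        (Computable.succ.comp (Computable.fst.comp Computable.fst))
    · refine (Computable.cond (hd.comp
        ((Computable.succ.comp Computable.snd).pair
          ((Computable.fst.comp (Computable.fst.comp Computable.fst)).pair
            (Computable.snd.comp Computable.fst)))
        (Computable.snd.comp (Computable.fst.comp Computable.fst)))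
        (Computable.const 1) (Computable.const 0)).of_eq fun q => ?_
      dsimp only
      cases d (q.2 + 1, q.1.1.1, q.1.2) q.1.1.2 <;> rfl
  have hsum : Computable fun q : (ℕ × ℕ × List ℕ) × ℕ =>
      ((L q.1.2.2).map (lowerCount d q.2.unpair.1 q.2.unpair.2)).sum := by
    refine computable_list_sum (f := fun q : (ℕ × ℕ × List ℕ) × ℕ => L q.1.2.2)
      (g := fun q σ => lowerCount d q.2.unpair.1 q.2.unpair.2 σ)
      (hL.comp (Computable.snd.comp (Computable.snd.comp Computable.fst))) ?_
    exact Computable.comp (f := fun p : (ℕ × ℕ) × List ℕ => lowerCount d p.1.1 p.1.2 p.2)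
      (g := fun r : ((ℕ × ℕ × List ℕ) × ℕ) × List ℕ => (r.1.2.unpair, r.2)) hcount
      ((Computable.unpair.comp (Computable.snd.comp Computable.fst)).pair Computable.snd)
  have hq : Computable₂ fun (p : ℕ × ℕ × List ℕ) (n : ℕ) =>
      decide (p.1 * (n.unpair.1 + 1) <
        ((L p.2.2).map (lowerCount d n.unpair.1 n.unpair.2)).sum * (p.2.1 + 1)) := by
    have hlt : Computable₂ fun a b : ℕ => decide (a < b) := Primrec.nat_lt.decide.to_comp
    refine hlt.comp (Primrec.nat_mul.to_comp.comp (Computable.fst.comp Computable.fst)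
      (Computable.succ.comp (Computable.fst.comp (Computable.unpair.comp Computable.snd))))
      (Primrec.nat_mul.to_comp.comp hsum (Computable.succ.comp
        (Computable.fst.comp (Computable.snd.comp Computable.fst))))
  refine REPred.of_eq (rePred_exists hq) fun p => ?_
  rw [lt_list_sum_iff hM hmono hspec]
  constructor
  · rintro ⟨n, hn⟩
    exact ⟨_, _, of_decide_eq_true hn⟩
  · rintro ⟨s, t, h⟩
    exact ⟨Nat.pair s t, by simpa using h⟩

/-! ### Recursively bounded trees -/

/-- The strings of length `l` bounded by `h` all of whose nonempty prefixes satisfy `R`. -/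
def tree (R : List ℕ → Bool) (h : ℕ → ℕ) : ℕ → List (List ℕ)
  | 0 => [[]]
  | l + 1 => (tree R h l).flatMap fun σ =>
      ((List.range (h l)).filter fun i => R (σ ++ [i])).map fun i => σ ++ [i]

/-- `Φ σ` is defined below `k`. -/
def definedBelow (Φ : List ℕ → ℕ → Option ℕ) (k : ℕ) (σ : List ℕ) : Bool :=
  (List.range k).all fun i => (Φ σ i).isSome

/-- `Φ σ` extends `τ`. -/
def extendsString (Φ : List ℕ → ℕ → Option ℕ) (σ τ : List ℕ) : Bool :=
  (List.range τ.length).all fun i => decide (Φ σ i = τ[i]?)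

/-- The total weight of the strings `σ` at level `l` of the tree for which `Φ σ` extends `τ`. -/
noncomputable def mass (M : List ℕ → ℝ≥0∞) (R : List ℕ → Bool) (h : ℕ → ℕ)
    (Φ : List ℕ → ℕ → Option ℕ) (l : ℕ) (τ : List ℕ) : ℝ≥0∞ :=
  (((tree R h l).filter fun σ => extendsString Φ σ τ).map M).sum

section Tree

variable {R : List ℕ → Bool} {h : ℕ → ℕ} {Φ : List ℕ → ℕ → Option ℕ} {M : List ℕ → ℝ≥0∞}

theorem mem_tree_succ {l : ℕ} {ρ : List ℕ} :
    ρ ∈ tree R h (l + 1) ↔ ∃ σ ∈ tree R h l, ∃ i, (i < h l ∧ R (σ ++ [i])) ∧ σ ++ [i] = ρ := by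
  simp [tree]

theorem initSeg_succ_mem_tree {X : ℕ → ℕ} {l : ℕ} :
    initSeg X (l + 1) ∈ tree R h (l + 1) ↔
      initSeg X l ∈ tree R h l ∧ X l < h l ∧ R (initSeg X (l + 1)) := by
  rw [mem_tree_succ]
  constructor
  · rintro ⟨σ, hσ, i, ⟨hi, hR⟩, heq⟩
    rw [← heq]
    rw [initSeg_succ] at heq
    obtain ⟨rfl, h2⟩ := List.append_inj' heq rfl
    simp only [List.cons.injEq, and_true] at h2
    exact ⟨hσ, h2 ▸ hi, hR⟩
  · rintro ⟨h1, h2, h3⟩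
    exact ⟨_, h1, _, ⟨h2, by rwa [initSeg_succ] at h3⟩, (initSeg_succ X l).symm⟩

theorem initSeg_mem_tree {X : ℕ → ℕ} (hR : ∀ n, R (initSeg X n)) (hX : ∀ n, X n < h n) (l : ℕ) :
    initSeg X l ∈ tree R h l := by
  induction l with
  | zero => simp [tree, initSeg]
  | succ l ih => exact initSeg_succ_mem_tree.2 ⟨ih, hX l, hR _⟩

/-- The string is continued by zeros. The bound is `≤` rather than `<` because `h n` may be `0`
beyond level `l`. -/
theorem exists_initSeg_eq_of_mem_tree {l : ℕ} {σ : List ℕ} (hσ : σ ∈ tree R h l) :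
    ∃ X : ℕ → ℕ, initSeg X l = σ ∧ ∀ n, X n ≤ h n := by
  induction l generalizing σ with
  | zero =>
    refine ⟨fun _ => 0, ?_, fun _ => Nat.zero_le _⟩
    simp_all [tree, initSeg]
  | succ l ih =>
    obtain ⟨ρ, hρ, i, ⟨hi, -⟩, rfl⟩ := mem_tree_succ.1 hσ
    obtain ⟨X, hX, hle⟩ := ih hρ
    refine ⟨Function.update X l i, ?_, fun n => ?_⟩
    · rw [initSeg_succ, Function.update_self, ← hX]
      congr 1
      refine List.map_congr_left fun j hj => ?_
      rw [Function.update_of_ne (List.mem_range.1 hj).ne]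
    · by_cases hn : n = l
      · subst hn; simpa using hi.le
      · rw [Function.update_of_ne hn]; exact hle n

theorem definedBelow_iff {k : ℕ} {σ : List ℕ} :
    definedBelow Φ k σ ↔ ∀ i < k, ∃ y, Φ σ i = some y := by
  simp [definedBelow, Option.isSome_iff_exists]

theorem extendsString_iff {σ τ : List ℕ} :
    extendsString Φ σ τ ↔ ∀ i < τ.length, Φ σ i = τ[i]? := by
  simp [extendsString]

theorem extendsString_append_iff {σ τ : List ℕ} {i : ℕ} :
    extendsString Φ σ (τ ++ [i]) ↔ extendsString Φ σ τ ∧ Φ σ τ.length = some i := by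
  simp only [extendsString_iff, List.length_append, List.length_singleton, Nat.forall_lt_succ_right]
  refine and_congr (forall₂_congr fun j hj => ?_) (by simp)
  rw [List.getElem?_append_left hj]

theorem definedBelow_append (hΦ : ∀ σ ρ n y, Φ σ n = some y → Φ (σ ++ ρ) n = some y) {k : ℕ}
    {σ : List ℕ} (hσ : definedBelow Φ k σ) (ρ : List ℕ) : definedBelow Φ k (σ ++ ρ) := by
  rw [definedBelow_iff] at hσ ⊢
  intro i hi
  obtain ⟨y, hy⟩ := hσ i hi
  exact ⟨y, hΦ _ _ _ _ hy⟩

theorem forall_definedBelow_of_le (hΦ : ∀ σ ρ n y, Φ σ n = some y → Φ (σ ++ ρ) n = some y)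
    {k l m : ℕ} (hlm : l ≤ m) (hl : ∀ σ ∈ tree R h l, definedBelow Φ k σ) :
    ∀ σ ∈ tree R h m, definedBelow Φ k σ := by
  induction m, hlm using Nat.le_induction with
  | base => exact hl
  | succ m _ ih =>
    intro σ hσ
    obtain ⟨ρ, hρ, i, -, rfl⟩ := mem_tree_succ.1 hσ
    exact definedBelow_append hΦ (ih ρ hρ) _

theorem isClosed_setOf_initSeg (p : List ℕ → Prop) (l : ℕ) :
    IsClosed {X : ℕ → ℕ | p (initSeg X l)} := by
  have heq : {X : ℕ → ℕ | p (initSeg X l)} =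
      (fun (X : ℕ → ℕ) (i : Fin l) => X i) ⁻¹' {x | p (List.ofFn x)} := by
    ext X
    have : initSeg X l = List.ofFn fun i : Fin l => X i := by
      rw [initSeg, List.ofFn_eq_map, ← List.map_coe_finRange_eq_range, List.map_map]
      rfl
    simp [this]
  rw [heq]
  exact (isClosed_discrete _).preimage (by fun_prop)

/-- By compactness, a functional that is total on the paths of a bounded tree is defined below `k`
on a whole level of the tree. -/
theorem exists_level_definedBelow (hΦ : ∀ σ ρ n y, Φ σ n = some y → Φ (σ ++ ρ) n = some y)
    (hR0 : R [])
    (htotal : ∀ X, (∀ n, R (initSeg X n)) → ∀ i, ∃ l y, Φ (initSeg X l) i = some y) (k : ℕ) :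
    ∃ l, ∀ σ ∈ tree R h l, definedBelow Φ k σ := by
  by_contra! hcon
  -- If every level has a bad string, these nested compact sets are nonempty. A common point is a
  -- path along which `Φ` never becomes defined below `k`, against `htotal`.
  let C : ℕ → Set (ℕ → ℕ) := fun l => (Set.univ.pi fun n => Set.Iic (h n)) ∩
    {X | initSeg X l ∈ tree R h l ∧ ¬ definedBelow Φ k (initSeg X l)}
  have hK : IsCompact (Set.univ.pi fun n => Set.Iic (h n)) :=
    isCompact_univ_pi fun n => (Set.finite_Iic (h n)).isCompact
  have hclosed : ∀ l, IsClosed (C l) := fun l =>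
    hK.isClosed.inter (isClosed_setOf_initSeg
      (fun σ => σ ∈ tree R h l ∧ ¬ definedBelow Φ k σ) l)
  have hanti : ∀ l, C (l + 1) ⊆ C l := by
    rintro l X ⟨hX, hmem, hnd⟩
    refine ⟨hX, (initSeg_succ_mem_tree.1 hmem).1, fun hd => hnd ?_⟩
    rw [initSeg_succ]
    exact definedBelow_append hΦ hd _
  have hne : ∀ l, (C l).Nonempty := by
    intro l
    obtain ⟨σ, hσ, hnd⟩ := hcon l
    obtain ⟨X, rfl, hX⟩ := exists_initSeg_eq_of_mem_tree hσ
    exact ⟨X, fun n _ => hX n, hσ, hnd⟩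
  obtain ⟨X, hX⟩ := IsCompact.nonempty_iInter_of_sequence_nonempty_isCompact_isClosed C hanti hne
    (hK.of_isClosed_subset (hclosed 0) Set.inter_subset_left) hclosed
  have hXC : ∀ l, X ∈ C l := Set.mem_iInter.1 hX
  have hXR : ∀ n, R (initSeg X n) := by
    rintro (_ | n)
    · exact hR0
    · exact (initSeg_succ_mem_tree.1 (hXC (n + 1)).2.1).2.2
  choose u y hu using htotal X hXR
  refine (hXC ((Finset.range k).sup u)).2.2 (definedBelow_iff.2 fun i hi => ⟨y i, ?_⟩)
  have hle : u i ≤ (Finset.range k).sup u := Finset.le_sup (Finset.mem_range.2 hi)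
  have := hΦ _ ((initSeg X ((Finset.range k).sup u)).drop (u i)) _ _ (hu i)
  rwa [← take_initSeg X hle, List.take_append_drop] at this

/-! ### The weight of the strings mapped to an extension of a given string -/

/-- By `hl`, whether `Φ σ` extends `τ` is settled at level `l`: a child can count only if its parent
does, and the children of `σ` weigh at most `M σ` together. A string still undecided could acquire
counted children and increase the mass. -/
theorem mass_succ_le (hM : IsContinuousSemimeasure M)
    (hΦ : ∀ σ ρ n y, Φ σ n = some y → Φ (σ ++ ρ) n = some y) {l : ℕ} {τ : List ℕ}
    (hl : ∀ σ ∈ tree R h l, definedBelow Φ τ.length σ) :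
    mass M R h Φ (l + 1) τ ≤ mass M R h Φ l τ := by
  rw [mass, mass, sum_map_filter_eq, sum_map_filter_eq, tree, sum_map_flatMap_eq]
  refine List.sum_le_sum fun σ hσ => ?_
  rw [List.map_map, sum_map_filter_eq]
  split_ifs with hext
  · refine le_trans (List.sum_le_sum fun i _ => ?_)
      ((sum_map_range_le_tsum (h l) fun i => M (σ ++ [i])).trans (hM.sum_le σ))
    simp only [Function.comp_apply]
    split_ifs <;> simp
  · refine le_of_eq (List.sum_eq_zero fun x hx => ?_)
    obtain ⟨i, -, rfl⟩ := List.mem_map.1 hx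
    have : ¬ extendsString Φ (σ ++ [i]) τ := by
      intro he
      refine hext (extendsString_iff.2 fun j hj => ?_)
      obtain ⟨y, hy⟩ := definedBelow_iff.1 (hl σ hσ) j hj
      rw [← extendsString_iff.1 he j hj, hy, hΦ _ _ _ _ hy]
    simp [this]

theorem mass_anti (hM : IsContinuousSemimeasure M)
    (hΦ : ∀ σ ρ n y, Φ σ n = some y → Φ (σ ++ ρ) n = some y) {l m : ℕ} (hlm : l ≤ m) {τ : List ℕ}
    (hl : ∀ σ ∈ tree R h l, definedBelow Φ τ.length σ) :
    mass M R h Φ m τ ≤ mass M R h Φ l τ := by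
  induction m, hlm using Nat.le_induction with
  | base => exact le_rfl
  | succ m hlm ih =>
    exact (mass_succ_le hM hΦ (forall_definedBelow_of_le hΦ hlm hl)).trans ih

/-- Each `σ` contributes to at most one `i`, namely the value of `Φ σ` at `|τ|`. -/
theorem tsum_mass_append_le (l : ℕ) (τ : List ℕ) :
    ∑' i, mass M R h Φ l (τ ++ [i]) ≤ mass M R h Φ l τ := by
  simp only [mass, sum_map_filter_eq]
  rw [tsum_list_sum]
  refine List.sum_le_sum fun σ _ => ?_
  simp only [extendsString_append_iff]
  by_cases hext : extendsString Φ σ τ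
  · simp only [hext, true_and, if_true]
    cases hy : Φ σ τ.length with
    | none => simp
    | some j =>
      rw [tsum_eq_single j]
      · simp
      · intro i hi
        simp [hi.symm]
  · simp [hext]

theorem mass_zero_nil : mass M R h Φ 0 [] = M [] := by
  simp [mass, tree, extendsString]

theorem mass_le_mass_nil (l : ℕ) (τ : List ℕ) : mass M R h Φ l τ ≤ mass M R h Φ l [] := by
  simp only [mass, sum_map_filter_eq]
  refine List.sum_le_sum fun σ _ => ?_
  have : extendsString Φ σ [] := extendsString_iff.2 (by simp)
  simp only [this, if_true]
  split_ifs <;> simp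

/-- The children of `τ` are compared with `τ` at their own level `g (|τ| + 1)`, and then the mass of
`τ` is compared between the two levels. The condition `g 0 = 0` gives the empty string the full
weight `M [] = 1`, which dead ends could reduce at a higher level. -/
theorem isContinuousSemimeasure_mass (hM : IsContinuousSemimeasure M)
    (hΦ : ∀ σ ρ n y, Φ σ n = some y → Φ (σ ++ ρ) n = some y) {g : ℕ → ℕ} (hg : Monotone g)
    (hg0 : g 0 = 0) (hgd : ∀ k, ∀ σ ∈ tree R h (g k), definedBelow Φ k σ) :
    IsContinuousSemimeasure fun τ => mass M R h Φ (g τ.length) τ where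
  le_one τ := by
    refine (mass_le_mass_nil _ _).trans ((mass_anti hM hΦ (Nat.zero_le _) ?_).trans ?_)
    · simp [definedBelow]
    · rw [mass_zero_nil, hM.nil_eq]
  nil_eq := by simp only [List.length_nil, hg0, mass_zero_nil, hM.nil_eq]
  sum_le τ := by
    simp only [List.length_append, List.length_singleton]
    exact (tsum_mass_append_le _ τ).trans (mass_anti hM hΦ (hg (Nat.le_succ _)) (hgd _))

/-- If `Φ` maps every string of `S`, all at level `l`, to an extension of some string of `T`,
then the weight of `S` is at most the total mass over `T`. -/
theorem tsum_le_tsum_mass {S T : Set (List ℕ)} {l : ℕ} (hS : ∀ σ ∈ S, σ ∈ tree R h l)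
    (hST : ∀ σ ∈ S, ∃ τ ∈ T, extendsString Φ σ τ) :
    ∑' σ : S, M σ ≤ ∑' τ : T, mass M R h Φ l τ := by
  calc ∑' σ : S, M σ ≤ ∑' σ : S, ∑' τ : T, if extendsString Φ σ τ then M σ else 0 := by
        refine ENNReal.tsum_le_tsum fun σ => ?_
        obtain ⟨τ, hτ, he⟩ := hST σ σ.2
        refine le_trans ?_ (ENNReal.le_tsum (⟨τ, hτ⟩ : T))
        simp [he]
    _ = ∑' τ : T, ∑' σ : S, if extendsString Φ σ τ then M σ else 0 := ENNReal.tsum_comm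
    _ ≤ ∑' τ : T, mass M R h Φ l τ := by
        refine ENNReal.tsum_le_tsum fun τ => ?_
        rw [mass, sum_map_filter_eq]
        exact tsum_subtype_le_list_sum S _ hS fun σ => if extendsString Φ σ τ then M σ else 0

/-! ### Computability -/

theorem computable_tree (hR : Computable R) (hh : Computable h) : Computable (tree R h) := by
  have happ : Computable fun q : List ℕ × ℕ => q.1 ++ [q.2] := Computable.list_concat
  have hinner : Computable₂ fun (q : ℕ × List (List ℕ)) (σ : List ℕ) =>
      ((List.range (h q.1)).filter fun i => R (σ ++ [i])).map fun i => σ ++ [i] := by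
    have hsnoc : Computable fun p : ((ℕ × List (List ℕ)) × List ℕ) × ℕ => p.1.2 ++ [p.2] :=
      Computable.comp (f := fun q : List ℕ × ℕ => q.1 ++ [q.2])
        (g := fun p : ((ℕ × List (List ℕ)) × List ℕ) × ℕ => (p.1.2, p.2)) happ
        ((Computable.snd.comp Computable.fst).pair Computable.snd)
    refine computable_list_map (α := (ℕ × List (List ℕ)) × List ℕ)
      (f := fun p => (List.range (h p.1.1)).filter fun i => R (p.2 ++ [i]))
      (g := fun p i => p.2 ++ [i]) ?_ hsnoc
    exact computable_list_filter (g := fun (p : (ℕ × List (List ℕ)) × List ℕ) i => R (p.2 ++ [i]))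
      (Primrec.list_range.to_comp.comp (hh.comp (Computable.fst.comp Computable.fst)))
      (hR.comp hsnoc)
  have hstep : Computable fun q : ℕ × List (List ℕ) => q.2.flatMap fun σ =>
      ((List.range (h q.1)).filter fun i => R (σ ++ [i])).map fun i => σ ++ [i] :=
    computable_list_flatMap Computable.snd hinner
  refine (Computable.nat_rec (f := fun n : ℕ => n) (g := fun _ => ([[]] : List (List ℕ)))
    (h := fun _ q => q.2.flatMap fun σ =>
      ((List.range (h q.1)).filter fun i => R (σ ++ [i])).map fun i => σ ++ [i])
    Computable.id (Computable.const _) (hstep.comp Computable.snd)).of_eq fun n => ?_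
  induction n with
  | zero => rfl
  | succ n ih => simp only [tree, ← ih]

theorem computable_definedBelow (hc : Computable₂ Φ) : Computable₂ (definedBelow Φ) := by
  refine computable_list_all (α := ℕ × List ℕ) (f := fun p => List.range p.1)
    (g := fun p i => (Φ p.2 i).isSome) (Primrec.list_range.to_comp.comp Computable.fst) ?_
  exact Primrec.option_isSome.to_comp.comp
    (hc.comp (Computable.snd.comp Computable.fst) Computable.snd)

theorem computable_extendsString (hc : Computable₂ Φ) : Computable₂ (extendsString Φ) := by
  refine computable_list_all (α := List ℕ × List ℕ) (f := fun p => List.range p.2.length)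
    (g := fun p i => decide (Φ p.1 i = p.2[i]?))
    (Primrec.list_range.to_comp.comp (Computable.list_length.comp Computable.snd)) ?_
  have heq : Computable₂ fun a b : Option ℕ => decide (a = b) := Primrec.eq.decide.to_comp
  exact heq.comp (hc.comp (Computable.fst.comp Computable.fst) Computable.snd)
    (Computable.list_getElem?.comp (Computable.snd.comp Computable.fst) Computable.snd)

theorem exists_computable_level (hR : Computable R) (hh : Computable h) (hc : Computable₂ Φ)
    (hΦ : ∀ σ ρ n y, Φ σ n = some y → Φ (σ ++ ρ) n = some y)
    (hex : ∀ k, ∃ l, ∀ σ ∈ tree R h l, definedBelow Φ k σ) :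
    ∃ g : ℕ → ℕ, Computable g ∧ Monotone g ∧ g 0 = 0 ∧ (∀ k, k ≤ g k) ∧
      ∀ k, ∀ σ ∈ tree R h (g k), definedBelow Φ k σ := by
  -- Requiring `k ≤ l` makes the least such `l` unbounded in `k`, as an order function must be.
  let p : ℕ → ℕ → Prop := fun k l => k ≤ l ∧ (tree R h l).all (definedBelow Φ k) = true
  have hp : ∀ k, ∃ l, p k l := by
    intro k
    obtain ⟨l, hl⟩ := hex k
    exact ⟨max k l, le_max_left _ _, List.all_eq_true.2
      (forall_definedBelow_of_le hΦ (le_max_right _ _) hl)⟩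
  have hpc : ComputablePred fun q : ℕ × ℕ => p q.1 q.2 := by
    refine Computable.computablePred ?_
    have hle : Computable₂ fun a b : ℕ => decide (a ≤ b) := Primrec.nat_le.decide.to_comp
    refine (Primrec.and.to_comp.comp (hle.comp Computable.fst Computable.snd)
      (computable_list_all (α := ℕ × ℕ) (f := fun q => tree R h q.2)
        (g := fun q σ => definedBelow Φ q.1 σ) ((computable_tree hR hh).comp Computable.snd)
        ((computable_definedBelow hc).comp (Computable.fst.comp Computable.fst)
          Computable.snd))).of_eq fun q => ?_
    rw [Bool.eq_iff_iff]
    simp [p]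
  refine ⟨fun k => Nat.find (hp k), Computable.find hpc hp, ?_, ?_,
    fun k => (Nat.find_spec (hp k)).1, fun k => List.all_eq_true.1 (Nat.find_spec (hp k)).2⟩
  · intro k m hkm
    refine Nat.find_min' _ ⟨hkm.trans (Nat.find_spec (hp m)).1, List.all_eq_true.2 fun σ hσ => ?_⟩
    have := definedBelow_iff.1 (List.all_eq_true.1 (Nat.find_spec (hp m)).2 σ hσ)
    exact definedBelow_iff.2 fun i hi => this i (hi.trans_le hkm)
  · exact (Nat.find_eq_zero _).2 ⟨le_rfl, by simp [definedBelow]⟩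

end Tree

/-! ### Depth is inherited by preimages -/

theorem IsDeep.of_range {M : List ℕ → ℝ≥0∞} (hM : IsUniversalSemimeasure M) {P : Set (ℕ → ℕ)}
    {Ψ : P → (ℕ → ℕ)} (hP : IsRBPi01 P) (hΨ : IsRecursiveFunctional Ψ)
    (hdeep : IsDeep M (Set.range Ψ)) : IsDeep M P := by
  refine ⟨hP, ?_⟩
  -- `tree` does not test `R []`. If `R []` fails, then `P` is empty but the tree may still have
  -- paths, on which `Φ` need not be total; a member `X₀` supplies `R []`.
  rcases P.eq_empty_or_nonempty with rfl | ⟨X₀, hX₀⟩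
  · refine ⟨id, ⟨Computable.id, monotone_id, fun m => ⟨m, le_rfl⟩⟩, fun n => ?_⟩
    simp [restrict]
  obtain ⟨⟨R', hR', hPR'⟩, h, hh, hPh⟩ := hP
  obtain ⟨R, hR, rfl⟩ := ComputablePred.computable_iff.1 hR'
  obtain ⟨c, hcΨ⟩ := hΨ
  obtain ⟨Φ, hΦc, hΦ, hΦs⟩ := c.exists_approximation
  have hspec : ∀ (X : P) n, ∃ l, Φ (initSeg X l) n = some (Ψ X n) := fun X n =>
    (hΦs X n _).1 (by rw [hcΨ]; exact Part.mem_some _)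
  have htotal : ∀ X, (∀ n, R (initSeg X n)) → ∀ i, ∃ l y, Φ (initSeg X l) i = some y := by
    intro X hX i
    obtain ⟨l, hl⟩ := hspec ⟨X, (hPR' X).2 hX⟩ i
    exact ⟨l, _, hl⟩
  obtain ⟨g, hgc, hgm, hg0, hgk, hgd⟩ := exists_computable_level hR hh hΦc hΦ
    (exists_level_definedBelow hΦ ((hPR' X₀).1 hX₀ 0) htotal)
  have hsm := isContinuousSemimeasure_mass hM.semimeasure hΦ hgm hg0 hgd
  have hre : IsLeftRE fun τ => mass M R h Φ (g τ.length) τ := by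
    refine isLeftRE_list_sum hM.semimeasure.le_one hM.leftRE
      (L := fun τ => (tree R h (g τ.length)).filter fun σ => extendsString Φ σ τ) ?_
    exact computable_list_filter (g := fun τ σ => extendsString Φ σ τ)
      ((computable_tree hR hh).comp (hgc.comp Computable.list_length))
      ((computable_extendsString hΦc).comp Computable.snd Computable.fst)
  obtain ⟨C, hC⟩ := hM.dominates _ hsm hre
  obtain ⟨-, r, hr, hrM⟩ := hdeep
  -- The shift by `C` absorbs the constant of domination, because `C ≤ 2 ^ C`.
  refine ⟨fun n => g (r (n + C)), ⟨?_, ?_, ?_⟩, fun n => ?_⟩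
  · exact hgc.comp (hr.computable.comp
      (Primrec.nat_add.to_comp.comp Computable.id (Computable.const C)))
  · exact fun a b hab => hgm (hr.monotone (Nat.add_le_add_right hab C))
  · intro m
    obtain ⟨n, hn⟩ := hr.unbounded m
    exact ⟨n, hn.trans ((hr.monotone (Nat.le_add_right n C)).trans (hgk _))⟩
  · set k := r (n + C) with hk
    have hmap : ∀ σ ∈ restrict P (g k), ∃ τ ∈ restrict (Set.range Ψ) k, extendsString Φ σ τ := by
      rintro _ ⟨X, hX, rfl⟩
      have hXt : initSeg X (g k) ∈ tree R h (g k) :=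
        initSeg_mem_tree ((hPR' X).1 hX) (hPh X hX) _
      refine ⟨initSeg (Ψ ⟨X, hX⟩) k, ⟨_, ⟨⟨X, hX⟩, rfl⟩, rfl⟩, extendsString_iff.2 fun i hi => ?_⟩
      rw [length_initSeg] at hi
      rw [getElem?_initSeg, if_pos hi]
      obtain ⟨y, hy⟩ := definedBelow_iff.1 (hgd k _ hXt) i hi
      have hy' := (hΦs X i y).2 ⟨_, hy⟩
      rw [hcΨ ⟨X, hX⟩ i] at hy'
      rw [hy, Part.mem_some_iff.1 hy']
    calc ∑' σ : restrict P (g k), M σ.1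
        ≤ ∑' τ : restrict (Set.range Ψ) k, mass M R h Φ (g k) τ := by
          refine tsum_le_tsum_mass ?_ hmap
          rintro _ ⟨X, hX, rfl⟩
          exact initSeg_mem_tree ((hPR' X).1 hX) (hPh X hX) _
      _ ≤ ∑' τ : restrict (Set.range Ψ) k, (C : ℝ≥0∞) * M τ.1 := by
          refine ENNReal.tsum_le_tsum fun τ => ?_
          obtain ⟨Y, -, hY⟩ := τ.2
          -- All these `τ` have length `k`, so their values under the pushed-forward semimeasure are
          -- computed at the one level `g k`.
          have hlen : τ.1.length = k := by rw [← hY, length_initSeg]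
          have := hC τ.1
          rwa [hlen] at this
      _ = C * ∑' τ : restrict (Set.range Ψ) k, M τ.1 := ENNReal.tsum_mul_left
      _ ≤ 2 ^ C * (2 : ℝ≥0∞)⁻¹ ^ (n + C) := by
          refine mul_le_mul' ?_ (hrM _)
          exact_mod_cast C.lt_two_pow_self.le
      _ = (2 : ℝ≥0∞)⁻¹ ^ n := by
          rw [pow_add, mul_left_comm, ← mul_pow, ENNReal.mul_inv_cancel (by simp) (by simp),
            one_pow, mul_one]

/-- The inverse is a recursive functional on `Q` with range `P`, so `IsDeep.of_range` applies to it.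
-/
theorem IsDeep.of_recursivelyHomeomorphic {M : List ℕ → ℝ≥0∞} (hM : IsUniversalSemimeasure M)
    {P Q : Set (ℕ → ℕ)} (hQ : IsRBPi01 Q) {e : P ≃ Q}
    (he : IsRecursiveFunctional fun Y : Q => (e.symm Y : ℕ → ℕ)) (hP : IsDeep M P) :
    IsDeep M Q := by
  refine IsDeep.of_range hM hQ he ?_
  have : Set.range (fun Y : Q => (e.symm Y : ℕ → ℕ)) = P := by
    ext X
    constructor
    · rintro ⟨Y, rfl⟩
      exact (e.symm Y).2
    · exact fun hX => ⟨e ⟨X, hX⟩, by simp⟩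
  rwa [this]

end Depth

theorem mainTheorem6 (M : List ℕ → ℝ≥0∞) (hM : Depth.IsUniversalSemimeasure M) :
    (∀ (P : Set (ℕ → ℕ)) (Ψ : P → (ℕ → ℕ)), Depth.IsRBPi01 P →
      Depth.IsRecursiveFunctional Ψ → Depth.IsDeep M (Set.range Ψ) → Depth.IsDeep M P) ∧
    (∀ P Q : Set (ℕ → ℕ), Depth.IsRBPi01 P → Depth.IsRBPi01 Q →
      Depth.RecursivelyHomeomorphic P Q → (Depth.IsDeep M P ↔ Depth.IsDeep M Q)) := by
  refine ⟨fun P Ψ hP hΨ hdeep => hdeep.of_range hM hP hΨ, fun P Q hP hQ => ?_⟩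
  rintro ⟨e, he, he'⟩
  exact ⟨fun h => h.of_recursivelyHomeomorphic hM hQ he',
    fun h => h.of_recursivelyHomeomorphic (e := e.symm) hM hP he⟩
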